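/- **Elections.** An election consists of a finite non-empty set $V$ of $n$ voters, a finite non-empty set $C$ of candidates, and for each $v\in V$ a strict total order $\succ_v$ on $C$ (her ranking); $a\succeq_v b$ means $a=b$ or $a\succ_v b$. The plurality score $\mathrm{plu}(c)$ is the number of voters whose top choice is $c$. **The rule.** SimultaneousPluralityVeto works as follows. Initially all candidates remain ($W=C$), candidate $c$ has weight $\mathrm{plu}(c)$, and the time is $0$. While the time is less than $1$: (i) as long as some remaining candidate of weight $0$ is the bottom choice, among the remaining candidates, of some voter, such candidates are removed from $W$ (instantly); (ii) then all voters simultaneously decrement the weight of their bottom choice in $W$, each at rate $1$, until the first of the candidates being decremented reaches weight $0$, and the time advances accordingly. When time $1$ is reached, the remaining set $W$ is returned; its elements are the winners. **Distortion.** A (pseudo)metric $d$ on the disjoint union of $V$ and $C$ is consistent with the rankings if $a\succ_v b$ implies $d(v,a)\le d(v,b)$. Let $\mathrm{cost}(c,d)=\sum_{v\in V}d(v,c)$. The distortion of $c$ is $\sup_d \mathrm{cost}(c,d)/\min_{c'\in C}\mathrm{cost}(c',d)$ over all consistent (pseudo)metrics $d$ (with $0/0:=0$ and $x/0:=\infty$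 for $x>0$). **Theorem.** For every election, the execution reaches time exactly $1$ after finitely many passes, and the following hold for the returned set $W$. 1. $W$ is non-empty, and it is a set of tied winners: there is a matrix $M\colon V\times C\to\mathbb{R}_{\ge0}$ with $\sum_{c}M(v,c)=1$ for all $v$ and $\sum_v M(v,c)=\mathrm{plu}(c)$ for all $c$, such that $W=\{a\in C : a\succeq_v c \text{ whenever } M(v,c)\ne 0\}$. 2. Every $w\in W$ has distortion at most $3$. 3. $W$ is convex in every consistent embedding: if voters and candidates are placed at points $x_v$, $y_c$ (not necessarily distinct) of a real normed space of dimension at least $1$ such that $a\succ_v b$ implies $\|x_v-y_a\|\le\|x_v-y_b\|$, then no candidate outside $W$ lies in the topological interior of the convex hull of $\{y_c : c\in W\}$. The same holds in every (pseudo)metric space equipped with a hull operator (a closure operator on subsets) for which open balls are convex (equal to their hull), provided that the interior of each closed ball is the open ball of the same center and radius. Moreover, the rule satisfies the following axioms. - *Anonymity*: renaming the voters does not change $W$. - *Neutrality*: renaming the candidates renames $W$ accordingly. - *Resolvability*: if $w\in W$ and a new voter is added whose top choice is $w$ (her ranking being otherwise arbitrary), then $w$ is the unique winner of the new election. - *Monotonicity*: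 if $w\in W$ and one voter moves $w$ higher up in her ranking (keeping the relative order of the other candidates), then $w$ is still a winner. - *Mutual Majority*: if $S\subseteq C$ is non-empty and strictly more than $n/2$ voters rank all candidates in $S$ ahead of all other candidates, then $W\subseteq S$. *Majority* is this property for singletons $S$, and *Majority Loser* is this property for (non-empty) complements $S$ of singletons. - *Reversal Symmetry*: if there are at least two candidates, $w$ is the unique winner, and the ranking of every voter is reversed, then $w$ is not a winner of the reversed election. -/

import Mathlib

open scoped ENNReal

universe u v w

noncomputable section

namespace SocialChoice

/-! ### Elections -/

/-- A ranking (strict total order) of the candidates; `r.prefers a b` means `a ≻ b`. -/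
@[ext]
structure Ranking (C : Type v) where
  prefers : C → C → Prop
  irrefl : ∀ a, ¬ prefers a a
  trans : ∀ a b c, prefers a b → prefers b c → prefers a c
  total : ∀ a b, a ≠ b → prefers a b ∨ prefers b a

namespace Ranking

/-- `c` is the top choice. -/
def IsTop {C : Type v} (r : Ranking C) (c : C) : Prop :=
  ∀ b, b ≠ c → r.prefers c b

/-- The reversed ranking. -/
def reverse {C : Type v} (r : Ranking C) : Ranking C where
  prefers a b := r.prefers b a
  irrefl := r.irrefl
  trans _ _ _ h₁ h₂ := r.trans _ _ _ h₂ h₁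
  total _ _ h := (r.total _ _ h).symm

/-- The ranking obtained by renaming the candidates along `e`. -/
def rename {C : Type v} {C' : Type v} (e : C ≃ C') (r : Ranking C) : Ranking C' where
  prefers a b := r.prefers (e.symm a) (e.symm b)
  irrefl _ := r.irrefl _
  trans _ _ _ := r.trans _ _ _
  total _ _ h := r.total _ _ (fun h' => h (e.symm.injective h'))

/-- `r'` arises from `r` by moving `w` (weakly) upwards: the other candidates keep their relative
order, and whoever was ranked below `w` still is. -/
def IsLift {C : Type v} (w : C) (r r' : Ranking C) : Prop :=
  (∀ a b, a ≠ w → b ≠ w → (r'.prefers a b ↔ r.prefers a b)) ∧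
    ∀ a, r.prefers w a → r'.prefers w a

end Ranking

/-- A ranked-choice profile: one ranking for each voter. -/
abbrev Profile (V : Type u) (C : Type v) := V → Ranking C

section Rule

variable {V : Type u} {C : Type v} [Fintype V] [Fintype C]

open Classical in
/-- The plurality score: the number of voters whose top choice is `c`. -/
def plu (P : Profile V C) (c : C) : ℕ :=
  (Finset.univ.filter fun v => (P v).IsTop c).card

/-! ### Simultaneous veto -/

open Classical in
/-- The voters whose bottom choice among the candidates in `W` is `c`
(no voter if `c` is not in `W`). -/
def opponents (P : Profile V C) (W : Finset C) (c : C) : Finset V :=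
  Finset.univ.filter fun v => c ∈ W ∧ ∀ b ∈ W, b ≠ c → (P v).prefers b c

open Classical in
/-- The remaining candidates of weight `0` that are the bottom choice, among the remaining
candidates, of at least one voter. -/
def exhausted (P : Profile V C) (wt : C → ℝ) (W : Finset C) : Finset C :=
  W.filter fun c => wt c = 0 ∧ (opponents P W c).Nonempty

open Classical in
/-- Instant elimination: as long as some remaining candidate of weight `0` is the bottom choice of
a voter, such candidates are removed. -/
def eliminate (P : Profile V C) (wt : C → ℝ) (W : Finset C) : Finset C :=
  if (exhausted P wt W).Nonempty then eliminate P wt (W \ exhausted P wt W) else W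
termination_by W.card
decreasing_by
  rename_i h
  obtain ⟨c, hc⟩ := h
  have hW : c ∈ W := (Finset.mem_filter.mp hc).1
  apply Finset.card_lt_card
  refine ⟨Finset.sdiff_subset, fun hsub => ?_⟩
  exact (Finset.mem_sdiff.mp (hsub hW)).2 hc

/-- The rate at which the weight of `c` is decremented while `W` is the set of remaining
candidates: every voter `v` decrements her bottom choice in `W` at rate `p v`. -/
def vetoRate (P : Profile V C) (p : V → ℝ) (W : Finset C) (c : C) : ℝ :=
  ∑ v ∈ opponents P W c, p v

/-- The time until the first of the opposed candidates in `W` runs out of weight. -/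
def timeToNext (P : Profile V C) (p : V → ℝ) (wt : C → ℝ) (W : Finset C) : ℝ :=
  sInf {δ | ∃ c ∈ W, 0 < vetoRate P p W c ∧ δ = wt c / vetoRate P p W c}

/-- The state of the execution: remaining candidates, current weights, current time. -/
structure VetoState (C : Type v) where
  remaining : Finset C
  weight : C → ℝ
  time : ℝ

open Classical in
/-- One pass through the loop `while time < 1`: eliminate instantly, then let all voters
decrement simultaneously until the next candidate runs out of weight. -/
def vetoStep (P : Profile V C) (p : V → ℝ) (s : VetoState C) : VetoState C :=
  if s.time < 1 then
    let W := eliminate P s.weight s.remaining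
    let δ := timeToNext P p s.weight W
    { remaining := W
      weight := fun c => s.weight c - δ * vetoRate P p W c
      time := s.time + δ }
  else s

/-- The state after `k` passes, from time `0`, all candidates remaining, and initial weights `q`.
It no longer changes after time `1` has been reached. -/
def vetoRun (P : Profile V C) (p : V → ℝ) (q : C → ℝ) (k : ℕ) : VetoState C :=
  (vetoStep P p)^[k] { remaining := Finset.univ, weight := q, time := 0 }

/-- SimultaneousVeto with voter weights `p` and candidate weights `q` (of the same total weight):
the candidates that are never eliminated. -/
def simultaneousVeto (P : Profile V C) (p : V → ℝ) (q : C → ℝ) : Set C :=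
  {c | ∀ k, c ∈ (vetoRun P p q k).remaining}

/-- `M` is a `(p, q)`-matching. -/
def IsMatching (p : V → ℝ) (q : C → ℝ) (M : V → C → ℝ) : Prop :=
  (∀ v c, 0 ≤ M v c) ∧ (∀ v, ∑ c, M v c = p v) ∧ ∀ c, ∑ v, M v c = q c

end Rule

/-- The set of winners tied at `M`: the candidates `a` that admit `M`, that is, `a ⪰_v c` whenever
`M v c ≠ 0`. -/
def tiedAt {V : Type u} {C : Type v} (P : Profile V C) (M : V → C → ℝ) : Set C :=
  {a | ∀ v c, M v c ≠ 0 → a = c ∨ (P v).prefers a c}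

/-! ### Metric distortion -/

/-- The voter-candidate distances `d` are consistent with the rankings. -/
def Consistent {V : Type u} {C : Type v} (P : Profile V C) (d : V → C → ℝ) : Prop :=
  ∀ v a b, (P v).prefers a b → d v a ≤ d v b

/-- Social cost of `c` under the (pseudo)metric `m` on voters and candidates. -/
def cost {V : Type u} {C : Type v} [Fintype V] (m : PseudoMetricSpace (V ⊕ C)) (c : C) : ℝ≥0∞ :=
  ENNReal.ofReal (∑ v, m.dist (Sum.inl v) (Sum.inr c))

/-- The distortion of `c`: the supremum, over all (pseudo)metrics on voters and candidates
consistent with the rankings, of the ratio between the cost of `c` and the optimal cost.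
In `ℝ≥0∞`, `x / 0 = ∞` for `x > 0`; only `0 / 0` (possible for proper pseudometrics) counts
as `0`. -/
def distortion {V : Type u} {C : Type v} [Fintype V] (P : Profile V C) (c : C) : ℝ≥0∞ :=
  ⨆ (m : PseudoMetricSpace (V ⊕ C))
    (_ : Consistent P fun v a => m.dist (Sum.inl v) (Sum.inr a)),
    cost m c / ⨅ c', cost m c'

/-! ### Voting rules and axioms -/

/-- A voting rule assigns to each election a set of (tied) winners. -/
def VotingRule : Type (max (u + 1) (v + 1)) :=
  ∀ (V : Type u) (C : Type v) [Fintype V] [Nonempty V] [Fintype C] [Nonempty C],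
    Profile V C → Set C

/-- SimultaneousPluralityVeto: each voter has weight `1`, and the initial weights of the
candidates are their plurality scores. -/
def simultaneousPluralityVeto : VotingRule.{u, v} :=
  fun _ _ _ _ _ _ P => simultaneousVeto P (fun _ => 1) (fun c => (plu P c : ℝ))

/-- The outcome does not depend on the identities of the voters. -/
def Anonymity (f : VotingRule.{u, v}) : Prop :=
  ∀ (V V' : Type u) (C : Type v) [Fintype V] [Nonempty V] [Fintype V'] [Nonempty V']
    [Fintype C] [Nonempty C] (e : V' ≃ V) (P : Profile V C),
    f V' C (fun v => P (e v)) = f V C P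

/-- Renaming the candidates renames the winners. -/
def Neutrality (f : VotingRule.{u, v}) : Prop :=
  ∀ (V : Type u) (C C' : Type v) [Fintype V] [Nonempty V] [Fintype C] [Nonempty C]
    [Fintype C'] [Nonempty C'] (e : C ≃ C') (P : Profile V C),
    f V C' (fun v => (P v).rename e) = e '' f V C P

/-- Adding one voter with ranking `r`. -/
def addVoter {V : Type u} {C : Type v} (P : Profile V C) (r : Ranking C) :
    Profile (Option V) C :=
  fun o => o.elim r P

/-- Adding a voter whose top choice is a winner `w` makes `w` the unique winner. -/
def Resolvability (f : VotingRule.{u, v}) : Prop :=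
  ∀ (V : Type u) (C : Type v) [Fintype V] [Nonempty V] [Fintype C] [Nonempty C]
    (P : Profile V C) (r : Ranking C) (w : C),
    w ∈ f V C P → r.IsTop w → f (Option V) C (addVoter P r) = {w}

/-- If a voter `v` moves a winner `w` higher up, then `w` still wins. -/
def Monotonicity (f : VotingRule.{u, v}) : Prop :=
  ∀ (V : Type u) (C : Type v) [Fintype V] [Nonempty V] [Fintype C] [Nonempty C]
    (P P' : Profile V C) (v : V) (w : C),
    w ∈ f V C P → (∀ x, x ≠ v → P' x = P x) → Ranking.IsLift w (P v) (P' v) → w ∈ f V C P'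

/-- A strict majority of the voters ranks all candidates in `S` ahead of all others. -/
def MajoritySupports {V : Type u} {C : Type v} [Fintype V] (P : Profile V C) (S : Set C) : Prop :=
  ∃ T : Finset V, Fintype.card V < 2 * T.card ∧
    ∀ v ∈ T, ∀ a ∈ S, ∀ b ∉ S, (P v).prefers a b

/-- If a strict majority ranks all candidates in the nonempty set `S` ahead of all others, then
all winners are in `S`. -/
def MutualMajority (f : VotingRule.{u, v}) : Prop :=
  ∀ (V : Type u) (C : Type v) [Fintype V] [Nonempty V] [Fintype C] [Nonempty C]
    (P : Profile V C) (S : Set C), S.Nonempty → MajoritySupports P S → f V C P ⊆ S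

/-- The mutual majority condition for singletons. -/
def Majority (f : VotingRule.{u, v}) : Prop :=
  ∀ (V : Type u) (C : Type v) [Fintype V] [Nonempty V] [Fintype C] [Nonempty C]
    (P : Profile V C) (c : C), MajoritySupports P {c} → f V C P ⊆ {c}

/-- The mutual majority condition for (nonempty) complements of singletons. -/
def MajorityLoser (f : VotingRule.{u, v}) : Prop :=
  ∀ (V : Type u) (C : Type v) [Fintype V] [Nonempty V] [Fintype C] [Nonempty C]
    (P : Profile V C) (c : C), ({c}ᶜ : Set C).Nonempty → MajoritySupports P {c}ᶜ →
    f V C P ⊆ {c}ᶜ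

/-- With at least two candidates: a unique winner no longer wins when all rankings are reversed. -/
def ReversalSymmetry (f : VotingRule.{u, v}) : Prop :=
  ∀ (V : Type u) (C : Type v) [Fintype V] [Nonempty V] [Fintype C] [Nontrivial C]
    (P : Profile V C) (w : C), f V C P = {w} → w ∉ f V C (fun v => (P v).reverse)

end SocialChoice

end

open SocialChoice

/-! An execution is encoded by its elimination times `T` (winners get `1`) and an elimination order
`l` that also separates candidates eliminated at the same instant. A voter vetoes `c` exactly from
the moment when everything below `c` is gone until `c` goes, so her veto time for `c` is `T c` minus
the maximum of `T` below `c`, truncated at zero. In an `IsVetoSchedule` these times sum over the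
voters to the weight of `c`, and each loser has a voter for whom everything below it goes earlier in
`l`. The run yields such a schedule (`exists_isVetoSchedule`).

The veto times form a plurality matching at which the winners are tied (`IsVetoSchedule.eq_tiedAt`).
This gives distortion at most 3 by the triangle inequality, and Mutual Majority by counting. Each
loser is ranked last, behind all winners, by some voter; the closed ball around her through the
loser contains all winners, whence convexity.

The other axioms compare schedules. By `IsVetoSchedule.le_of_embedding`, extra voters, lighter
losers and fewer candidates below the losers make no elimination later: a candidate eliminated later
than before would absorb more veto than its weight. In particular schedules are unique, which gives
Anonymity and Neutrality by transport. Resolvability adds a count of the new voter's vetoes,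
Reversal Symmetry a count of the vetoes against `w`, and Monotonicity compares both executions
stopped at the time when `w` would be eliminated. -/

namespace SocialChoice

open scoped NNReal

/-! ### Rankings and vetoes -/

namespace Ranking

variable {C : Type v}

theorem asymm (r : Ranking C) {a b : C} (h : r.prefers a b) : ¬ r.prefers b a :=
  fun h' => r.irrefl _ (r.trans _ _ _ h h')

theorem ne_of_prefers (r : Ranking C) {a b : C} (h : r.prefers a b) : a ≠ b := by
  rintro rfl
  exact r.irrefl _ h

/-- Every nonempty finite set of candidates has a bottom choice. -/
theorem exists_bottom (r : Ranking C) (W : Finset C) (hW : W.Nonempty) :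
    ∃ c ∈ W, ∀ b ∈ W, b ≠ c → r.prefers b c := by
  classical
  induction hW using Finset.Nonempty.cons_induction with
  | singleton a =>
    exact ⟨a, Finset.mem_singleton_self a, fun b hb hne => absurd (Finset.mem_singleton.mp hb) hne⟩
  | cons a s ha hs ih =>
    obtain ⟨c, hc, hbot⟩ := ih
    have hac : a ≠ c := fun h => ha (h ▸ hc)
    rcases r.total a c hac with h | h
    · refine ⟨c, Finset.mem_cons_of_mem hc, fun b hb hne => ?_⟩
      rcases Finset.mem_cons.mp hb with rfl | hb
      · exact h
      · exact hbot b hb hne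
    · refine ⟨a, Finset.mem_cons_self a s, fun b hb hne => ?_⟩
      rcases Finset.mem_cons.mp hb with rfl | hb
      · exact absurd rfl hne
      · by_cases hbc : b = c
        · exact hbc ▸ h
        · exact r.trans _ _ _ (hbot b hb hbc) h

theorem exists_top (r : Ranking C) (W : Finset C) (hW : W.Nonempty) :
    ∃ c ∈ W, ∀ b ∈ W, b ≠ c → r.prefers c b :=
  r.reverse.exists_bottom W hW

theorem IsTop.eq {r : Ranking C} {a b : C} (ha : r.IsTop a) (hb : r.IsTop b) : a = b := by
  by_contra hne
  exact r.asymm (ha b (Ne.symm hne)) (hb a hne)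

theorem exists_isTop [Fintype C] [Nonempty C] (r : Ranking C) : ∃ c, r.IsTop c := by
  obtain ⟨c, -, hc⟩ := r.exists_top Finset.univ Finset.univ_nonempty
  exact ⟨c, fun b hb => hc b (Finset.mem_univ b) hb⟩

variable [Fintype C]

open Classical in
/-- The candidates ranked below `c`. -/
noncomputable def below (r : Ranking C) (c : C) : Finset C :=
  Finset.univ.filter fun b => r.prefers c b

@[simp]
theorem mem_below (r : Ranking C) {b c : C} : b ∈ r.below c ↔ r.prefers c b := by
  simp [below]

/-- The amount of time that a voter with ranking `r` spends on vetoing `c`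
if every candidate `b` is eliminated at time `T b`. -/
noncomputable def veto (r : Ranking C) (T : C → ℝ≥0) (c : C) : ℝ≥0 :=
  T c - (r.below c).sup T

theorem sup_below_le (r : Ranking C) (T : C → ℝ≥0) {c : C} {t : ℝ≥0} :
    (r.below c).sup T ≤ t ↔ ∀ b, r.prefers c b → T b ≤ t := by
  simp [Finset.sup_le_iff]

/-- The condition `0 < T c` covers the bottom choice, for which the supremum is the empty one, `0`.
-/
theorem veto_ne_zero (r : Ranking C) (T : C → ℝ≥0) {c : C} :
    r.veto T c ≠ 0 ↔ 0 < T c ∧ ∀ b, r.prefers c b → T b < T c := by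
  rw [veto, ← pos_iff_ne_zero, tsub_pos_iff_lt]
  constructor
  · intro h
    exact ⟨lt_of_le_of_lt zero_le h, fun b hb =>
      lt_of_le_of_lt (Finset.le_sup (f := T) ((r.mem_below).mpr hb)) h⟩
  · rintro ⟨h0, h⟩
    exact (Finset.sup_lt_iff (by simpa using h0)).mpr fun b hb => h b (r.mem_below.mp hb)

/-- Telescoping over a set closed downwards: removing its top choice `a` leaves exactly the
candidates below `a`, and truncated subtraction plus the removed supremum is a maximum. -/
theorem sum_tsub_sup (r : Ranking C) (T : C → ℝ≥0) (S : Finset C)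
    (hS : ∀ c ∈ S, ∀ b, r.prefers c b → b ∈ S) : ∑ c ∈ S, r.veto T c = S.sup T := by
  classical
  induction hn : S.card generalizing S with
  | zero =>
    rw [Finset.card_eq_zero.mp hn]
    simp
  | succ n ih =>
    obtain ⟨a, ha, htop⟩ := r.exists_top S (Finset.card_pos.mp (by omega))
    have hbelow : r.below a = S.erase a := by
      ext b
      rw [mem_below, Finset.mem_erase]
      exact ⟨fun h => ⟨(r.ne_of_prefers h).symm, hS a ha b h⟩, fun h => htop b h.2 h.1⟩
    have ih' := ih (S.erase a) (fun c hc b hb => by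
      rw [Finset.mem_erase] at hc ⊢
      refine ⟨?_, hS c hc.2 b hb⟩
      rintro rfl
      exact r.asymm hb (htop c hc.2 hc.1)) (by rw [Finset.card_erase_of_mem ha]; omega)
    rw [← Finset.add_sum_erase S _ ha, ih', veto, hbelow, tsub_add_eq_max,
      ← Finset.insert_erase ha, Finset.sup_insert]
    simp

/-- Every voter is always vetoing somebody. -/
theorem sum_veto (r : Ranking C) (T : C → ℝ≥0) :
    ∑ c, r.veto T c = Finset.univ.sup T :=
  r.sum_tsub_sup T Finset.univ (fun _ _ b _ => Finset.mem_univ b)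

/-- Earlier elimination of the candidates below `c` and later elimination of `c` increase the
time spent on vetoing `c`. -/
theorem veto_le_veto {r r' : Ranking C} {T T' : C → ℝ≥0} {c : C} (hc : T c ≤ T' c)
    (h : (∀ b, r.prefers c b → T b < T c) → ∀ b, r'.prefers c b → r.prefers c b ∧ T' b ≤ T b) :
    r.veto T c ≤ r'.veto T' c := by
  -- Only a nonzero left-hand side needs an argument, and then the premise of `h` holds.
  by_cases h0 : r.veto T c = 0
  · rw [h0]
    exact zero_le
  · have h' := h ((r.veto_ne_zero T).mp h0).2
    refine tsub_le_tsub hc ((r'.sup_below_le T').mpr fun b hb => (h' b hb).2.trans ?_)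
    exact Finset.le_sup (f := T) (r.mem_below.mpr (h' b hb).1)

/-- Capping `T` at `t` stops the clock: the left-hand side is the veto time spent up to time `t`. -/
theorem veto_min_le (r : Ranking C) (T : C → ℝ≥0) (t : ℝ≥0) (c : C) :
    r.veto (fun b => min (T b) t) c ≤ r.veto T c := by
  have hs : (r.below c).sup (fun b => min (T b) t) = min ((r.below c).sup T) t := by
    simpa [inf_comm] using (Finset.sup_inf_distrib_right (r.below c) T t).symm
  rw [veto, veto, hs]
  rcases le_total ((r.below c).sup T) t with h | h
  · rw [min_eq_left h]
    exact tsub_le_tsub_right (min_le_left _ _) _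
  · rw [min_eq_right h, tsub_eq_zero_of_le (min_le_right _ _)]
    exact zero_le

theorem veto_min_of_le (r : Ranking C) (T : C → ℝ≥0) {t : ℝ≥0} {c : C} (h : T c ≤ t) :
    r.veto (fun b => min (T b) t) c = r.veto T c := by
  refine le_antisymm (r.veto_min_le T t c) ?_
  have hT : min (T c) t = T c := min_eq_left h
  rw [veto, veto, hT]
  exact tsub_le_tsub_left (Finset.sup_mono_fun fun b _ => min_le_left _ _) _

/-- Such a voter is still vetoing `c` just after time `t`. -/
theorem veto_min_lt (r : Ranking C) (T : C → ℝ≥0) {t : ℝ≥0} {c : C} (h : t < T c)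
    (hb : ∀ b, r.prefers c b → T b ≤ t) :
    r.veto (fun b => min (T b) t) c < r.veto T c := by
  have hs : (r.below c).sup (fun b => min (T b) t) = (r.below c).sup T :=
    Finset.sup_congr rfl fun b hb' => min_eq_left (hb b (r.mem_below.mp hb'))
  have hT : min (T c) t = t := min_eq_right h.le
  rw [veto, veto, hs, hT]
  have hle : (r.below c).sup T ≤ t := (r.sup_below_le T).mpr hb
  exact tsub_lt_tsub_right_of_le hle h

end Ranking

/-- `T` is a possible family of elimination times for SimultaneousVeto (`1` for the winners) in
which the candidates are eliminated in the order of increasing `l`. -/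
structure IsVetoSchedule {V : Type u} {C : Type v} [Fintype V] [Fintype C] (P : Profile V C)
    (q : C → ℝ≥0) (T : C → ℝ≥0) (l : C → ℕ) : Prop where
  le_one : ∀ c, T c ≤ 1
  sum_veto : ∀ c, ∑ v, (P v).veto T c = q c
  opposed : ∀ c, T c < 1 → ∃ v, ∀ b, (P v).prefers c b → l b < l c
  lt_of_lt : ∀ b c, T b < T c → l b < l c

/-! ### Consequences and comparison of schedules. -/

namespace IsVetoSchedule

variable {V : Type u} {C : Type v} [Fintype V] [Fintype C] {P : Profile V C} {q T : C → ℝ≥0}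
  {l : C → ℕ}

theorem le_of_lt (h : IsVetoSchedule P q T l) {b c : C} (hbc : l b < l c) : T b ≤ T c :=
  le_of_not_gt fun h' => (h.lt_of_lt _ _ h').asymm hbc

/-- An eliminated candidate is ranked behind all winners by some voter. -/
theorem exists_voter (h : IsVetoSchedule P q T l) {c : C} (hc : T c < 1) :
    ∃ v, ∀ a, T a = 1 → (P v).prefers a c := by
  obtain ⟨v, hv⟩ := h.opposed c hc
  refine ⟨v, fun a ha => ?_⟩
  rcases (P v).total a c (by rintro rfl; exact hc.ne ha) with h' | h'
  · exact h'
  · have := h.le_of_lt (hv a h')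
    rw [ha] at this
    exact absurd this (not_le.mpr hc)

/-- Double counting: each voter vetoes for a total time `sup T`, and the total weight is the number
of voters. -/
theorem sup_eq_one [Nonempty V] (h : IsVetoSchedule P q T l)
    (hq : ∑ c, q c = Fintype.card V) : Finset.univ.sup T = 1 := by
  have h1 : ∑ c, ∑ v, (P v).veto T c = ∑ c, q c := Finset.sum_congr rfl fun c _ => h.sum_veto c
  rw [Finset.sum_comm, hq, Finset.sum_congr rfl fun v _ => (P v).sum_veto T, Finset.sum_const,
    Finset.card_univ, nsmul_eq_mul] at h1
  exact mul_left_cancel₀ (Nat.cast_ne_zero.mpr Fintype.card_ne_zero) (h1.trans (mul_one _).symm)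

theorem exists_winner [Nonempty V] [Nonempty C] (h : IsVetoSchedule P q T l)
    (hq : ∑ c, q c = Fintype.card V) : ∃ c, T c = 1 := by
  obtain ⟨c, -, hc⟩ := Finset.exists_mem_eq_sup Finset.univ Finset.univ_nonempty T
  exact ⟨c, hc ▸ h.sup_eq_one hq⟩

/-- If every voter of `P` takes part in `P'`, no losing candidate is heavier in `P'`, and the
voters rank fewer candidates below it, then no candidate is eliminated later in `P'`. -/
theorem le_of_embedding {V' : Type*} [Fintype V'] {P' : Profile V' C} {q' T' : C → ℝ≥0}
    {l' : C → ℕ} (h : IsVetoSchedule P q T l) (h' : IsVetoSchedule P' q' T' l') (i : V ↪ V')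
    (hq : ∀ c, T c < 1 → q' c ≤ q c)
    (hP : ∀ v c b, T c < 1 → (P' (i v)).prefers c b → (P v).prefers c b) (c : C) :
    T' c ≤ T c := by
  -- Induction along `l` rather than `T`, because several candidates can be eliminated at the same
  -- time.
  induction hn : l c using Nat.strong_induction_on generalizing c with
  | _ n ih =>
    subst hn
    by_contra! hc
    have hc1 : T c < 1 := hc.trans_le (h'.le_one c)
    obtain ⟨v₀, hv₀⟩ := h.opposed c hc1
    have hlt : ∑ v, (P v).veto T c < ∑ v, (P' (i v)).veto T' c := by
      refine Finset.sum_lt_sum (fun v _ => ?_) ⟨v₀, Finset.mem_univ v₀, ?_⟩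
      · exact Ranking.veto_le_veto hc.le fun hb b hb' =>
          ⟨hP v c b hc1 hb', ih _ (h.lt_of_lt _ _ (hb b (hP v c b hc1 hb'))) b rfl⟩
      · have h1 : (P v₀).veto T c ≤ (P' (i v₀)).veto (fun b => min (T' b) (T c)) c := by
          refine Ranking.veto_le_veto (le_min hc.le le_rfl) fun hb b hb' =>
            ⟨hP v₀ c b hc1 hb', (min_le_left _ _).trans
              (ih _ (hv₀ b (hP v₀ c b hc1 hb')) b rfl)⟩
        refine h1.trans_lt (Ranking.veto_min_lt _ _ hc fun b hb => ?_)
        have hl := hv₀ b (hP v₀ c b hc1 hb)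
        exact (ih _ hl b rfl).trans (h.le_of_lt hl)
    have hle : ∑ v, (P' (i v)).veto T' c ≤ ∑ v, (P' v).veto T' c := by
      rw [← Finset.sum_map Finset.univ i fun v => (P' v).veto T' c]
      exact Finset.sum_le_sum_of_subset (Finset.subset_univ _)
    rw [h.sum_veto] at hlt
    rw [h'.sum_veto] at hle
    exact absurd (hq c hc1) (not_le.mpr (hlt.trans_le hle))

/-- The winners are tied at the matching given by the vetoes. -/
theorem eq_tiedAt [Nonempty V] [Nonempty C] (h : IsVetoSchedule P q T l)
    (hq : ∑ c, q c = Fintype.card V) :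
    {c | T c = 1} = tiedAt P fun v c => ((P v).veto T c : ℝ) := by
  classical
  ext a
  constructor
  · intro ha v c hvc
    have h0 := ((P v).veto_ne_zero T).mp (NNReal.coe_ne_zero.mp hvc)
    by_contra! hac
    have hca := ((P v).total a c hac.1).resolve_left hac.2
    have := h0.2 a hca
    rw [show T a = 1 from ha] at this
    exact absurd (h.le_one c) (not_le.mpr this)
  · intro ha
    by_contra hne
    have hlt : T a < 1 := lt_of_le_of_ne (h.le_one a) hne
    obtain ⟨v, hv⟩ := h.exists_voter hlt
    obtain ⟨c₀, hc₀⟩ := h.exists_winner hq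
    -- The bottom choice of `v` among the winners is vetoed by her at the very end, so admitting the
    -- matching would put `a` weakly ahead of it.
    obtain ⟨c, hc, hbot⟩ := (P v).exists_bottom (Finset.univ.filter fun c => T c = 1)
      ⟨c₀, by simp [hc₀]⟩
    have hc1 : T c = 1 := by simpa using hc
    have hvc : (P v).veto T c ≠ 0 := by
      refine ((P v).veto_ne_zero T).mpr ⟨by simp [hc1], fun b hb => ?_⟩
      rw [hc1]
      refine lt_of_le_of_ne (h.le_one b) fun hb1 => ?_
      exact (P v).asymm hb (hbot b (by simp [hb1]) ((P v).ne_of_prefers hb).symm)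
    rcases ha v c (NNReal.coe_ne_zero.mpr hvc) with rfl | hac
    · exact hne hc1
    · exact (P v).asymm hac (hv c hc1)

theorem isMatching [Nonempty V] (h : IsVetoSchedule P q T l)
    (hq : ∑ c, q c = Fintype.card V) :
    IsMatching (fun _ => 1) (fun c => (q c : ℝ)) fun v c => ((P v).veto T c : ℝ) := by
  refine ⟨fun v c => NNReal.coe_nonneg _, fun v => ?_, fun c => ?_⟩
  · rw [← NNReal.coe_sum, (P v).sum_veto, h.sup_eq_one hq, NNReal.coe_one]
  · rw [← NNReal.coe_sum, h.sum_veto]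

end IsVetoSchedule

/-! ### The execution -/

section Execution

variable {V : Type u} {C : Type v} [Fintype V] [Fintype C]

theorem mem_opponents {P : Profile V C} {W : Finset C} {c : C} {v : V} :
    v ∈ opponents P W c ↔ c ∈ W ∧ ∀ b ∈ W, b ≠ c → (P v).prefers b c := by
  simp [opponents]

theorem mem_exhausted {P : Profile V C} {wt : C → ℝ} {W : Finset C} {c : C} :
    c ∈ exhausted P wt W ↔ c ∈ W ∧ wt c = 0 ∧ (opponents P W c).Nonempty := by
  simp [exhausted]

theorem vetoRate_eq_card (P : Profile V C) (W : Finset C) (c : C) :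
    vetoRate P (fun _ => 1) W c = (opponents P W c).card := by
  simp [vetoRate]

theorem card_sdiff_exhausted_lt [DecidableEq C] {P : Profile V C} {wt : C → ℝ} {W : Finset C}
    (h : (exhausted P wt W).Nonempty) : (W \ exhausted P wt W).card < W.card :=
  Finset.card_lt_card (Finset.sdiff_ssubset (fun _ hc => (mem_exhausted.mp hc).1) h)

theorem sum_plu [Nonempty C] (P : Profile V C) : ∑ c, plu P c = Fintype.card V := by
  classical
  have h : ∀ v, ∃! c, (P v).IsTop c := fun v => by
    obtain ⟨c, hc⟩ := (P v).exists_isTop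
    exact ⟨c, hc, fun b hb => hb.eq hc⟩
  choose f hf hf' using h
  have hplu : ∀ c, plu P c = (Finset.univ.filter fun v => f v = c).card := fun c => by
    unfold plu
    congr 1
    ext v
    simp only [Finset.mem_filter, Finset.mem_univ, true_and]
    exact ⟨fun h => (hf' v c h).symm, fun h => h ▸ hf v⟩
  simp_rw [hplu]
  rw [← Finset.card_univ]
  exact (Finset.card_eq_sum_card_fiberwise fun v _ => Finset.mem_univ (f v)).symm

/-- The remaining candidates `W` and weights `wt` at time `t` arise from the initial weights `q`
by eliminations at times `T`, in the order of increasing `l`. -/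
structure IsPartialSchedule (P : Profile V C) (q wt : C → ℝ) (W : Finset C) (t : ℝ≥0)
    (T : C → ℝ≥0) (l : C → ℕ) : Prop where
  nonempty : W.Nonempty
  -- Remaining candidates provisionally carry the current time, so that `veto` measures the time
  -- spent so far.
  eq_of_mem : ∀ c ∈ W, T c = t
  le : ∀ c, T c ≤ t
  lt_one : ∀ c ∉ W, T c < 1
  weight_nonneg : ∀ c, 0 ≤ wt c
  weight_add : ∀ c, wt c + ((∑ v, (P v).veto T c : ℝ≥0) : ℝ) = q c
  weight_zero : ∀ c ∉ W, wt c = 0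
  opposed : ∀ c ∉ W, ∃ v, ∀ b, (P v).prefers c b → b ∉ W ∧ l b < l c
  lt_of_lt : ∀ c ∉ W, ∀ b, T b < T c → l b < l c

/-! ### Partial schedules persist under elimination and decrement. -/

namespace IsPartialSchedule

variable {P : Profile V C} {q wt : C → ℝ} {W : Finset C} {t : ℝ≥0} {T : C → ℝ≥0} {l : C → ℕ}

theorem notMem_of_lt (h : IsPartialSchedule P q wt W t T l) {b c : C} (hbc : T b < T c) :
    b ∉ W := fun hb => by
  rw [h.eq_of_mem b hb] at hbc
  exact (h.le c).not_gt hbc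

theorem sup_eq (h : IsPartialSchedule P q wt W t T l) : Finset.univ.sup T = t := by
  obtain ⟨c, hc⟩ := h.nonempty
  refine le_antisymm (Finset.sup_le fun c _ => h.le c) ?_
  rw [← h.eq_of_mem c hc]
  exact Finset.le_sup (f := T) (Finset.mem_univ c)

theorem sum_weight (h : IsPartialSchedule P q wt W t T l) (hq : ∑ c, q c = Fintype.card V) :
    ∑ c, wt c = Fintype.card V * (1 - t) := by
  have h1 : ∑ c, (wt c + ((∑ v, (P v).veto T c : ℝ≥0) : ℝ)) = Fintype.card V := by
    rw [← hq]
    exact Finset.sum_congr rfl fun c _ => h.weight_add c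
  rw [Finset.sum_add_distrib, ← NNReal.coe_sum, Finset.sum_comm,
    Finset.sum_congr rfl fun v _ => (P v).sum_veto T, h.sup_eq, Finset.sum_const,
    Finset.card_univ, nsmul_eq_mul] at h1
  push_cast at h1
  linarith

theorem le_one [Nonempty V] (h : IsPartialSchedule P q wt W t T l)
    (hq : ∑ c, q c = Fintype.card V) : t ≤ 1 := by
  have h0 : 0 ≤ ∑ c, wt c := Finset.sum_nonneg fun c _ => h.weight_nonneg c
  rw [h.sum_weight hq] at h0
  have hV : (0 : ℝ) < Fintype.card V := Nat.cast_pos.mpr Fintype.card_pos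
  have := nonneg_of_mul_nonneg_right h0 hV
  exact_mod_cast (by linarith : (t : ℝ) ≤ 1)

theorem exists_weight_pos [Nonempty V] (h : IsPartialSchedule P q wt W t T l)
    (hq : ∑ c, q c = Fintype.card V) (ht : t < 1) : ∃ c ∈ W, 0 < wt c := by
  have hV : (0 : ℝ) < Fintype.card V := Nat.cast_pos.mpr Fintype.card_pos
  have ht' : (t : ℝ) < 1 := by exact_mod_cast ht
  have h0 : 0 < ∑ c, wt c := by
    rw [h.sum_weight hq]
    exact mul_pos hV (by linarith)
  obtain ⟨c, -, hc⟩ : ∃ c ∈ Finset.univ, 0 < wt c := by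
    by_contra! hle
    exact (Finset.sum_nonpos hle).not_gt h0
  exact ⟨c, by_contra fun hcW => hc.ne' (h.weight_zero c hcW), hc⟩

theorem sdiff_exhausted [Nonempty V] [DecidableEq C] (h : IsPartialSchedule P q wt W t T l)
    (hq : ∑ c, q c = Fintype.card V) (ht : t < 1) :
    ∃ l', IsPartialSchedule P q wt (W \ exhausted P wt W) t T l' := by
  have hX : ∀ {c}, c ∉ W \ exhausted P wt W → c ∈ W → c ∈ exhausted P wt W := fun h1 h2 => by
    by_contra h3
    exact h1 (Finset.mem_sdiff.mpr ⟨h2, h3⟩)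
  have hW : ∀ {b}, b ∉ W → b ∉ W \ exhausted P wt W := fun h1 h2 =>
    h1 (Finset.mem_sdiff.mp h2).1
  have hN : ∀ b, l b < Finset.univ.sup l + 1 := fun b =>
    Nat.lt_succ_of_le (Finset.le_sup (f := l) (Finset.mem_univ b))
  -- The newly removed candidates come after all earlier ones in the order; the label of those still
  -- remaining is irrelevant.
  refine ⟨fun c => if c ∈ W then Finset.univ.sup l + 1 else l c, ?_, ?_, h.le, ?_,
    h.weight_nonneg, h.weight_add, ?_, ?_, ?_⟩
  · obtain ⟨c, hc, hpos⟩ := h.exists_weight_pos hq ht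
    exact ⟨c, Finset.mem_sdiff.mpr ⟨hc, fun hc' => hpos.ne' (mem_exhausted.mp hc').2.1⟩⟩
  · exact fun c hc => h.eq_of_mem c (Finset.mem_sdiff.mp hc).1
  · exact fun c _ => (h.le c).trans_lt ht
  · intro c hc
    by_cases hcW : c ∈ W
    · exact (mem_exhausted.mp (hX hc hcW)).2.1
    · exact h.weight_zero c hcW
  · intro c hc
    by_cases hcW : c ∈ W
    · obtain ⟨v, hv⟩ := (mem_exhausted.mp (hX hc hcW)).2.2
      refine ⟨v, fun b hb => ?_⟩
      have hbW : b ∉ W := fun hbW => (P v).asymm hb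
        ((mem_opponents.mp hv).2 b hbW ((P v).ne_of_prefers hb).symm)
      simp only [hbW, hcW, if_true, if_false]
      exact ⟨hW hbW, hN b⟩
    · obtain ⟨v, hv⟩ := h.opposed c hcW
      refine ⟨v, fun b hb => ?_⟩
      simp only [(hv b hb).1, hcW, if_false]
      exact ⟨hW (hv b hb).1, (hv b hb).2⟩
  · intro c hc b hbc
    have hbW := h.notMem_of_lt hbc
    by_cases hcW : c ∈ W
    · simp only [hbW, hcW, if_true, if_false]
      exact hN b
    · simp only [hbW, hcW, if_false]
      exact h.lt_of_lt c hcW b hbc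

theorem eliminate [Nonempty V] (h : IsPartialSchedule P q wt W t T l)
    (hq : ∑ c, q c = Fintype.card V) (ht : t < 1) :
    ∃ l', IsPartialSchedule P q wt (eliminate P wt W) t T l' := by
  classical
  induction hn : W.card using Nat.strong_induction_on generalizing W l with
  | _ n ih =>
    rw [SocialChoice.eliminate]
    split_ifs with hX
    · obtain ⟨l', h'⟩ := h.sdiff_exhausted hq ht
      refine ih _ ?_ (by convert h') rfl
      exact hn ▸ card_sdiff_exhausted_lt hX
    · exact ⟨l, h⟩

open Classical in
-- If somebody below `c` remains, both vetoes of `c` vanish; otherwise the times below `c` are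
-- unaffected, and `c` gains `δ` exactly if it remains.
theorem veto_add (h : IsPartialSchedule P q wt W t T l) (δ : ℝ≥0) (v : V) (c : C) :
    (P v).veto (fun b => if b ∈ W then t + δ else T b) c =
      (P v).veto T c + if v ∈ opponents P W c then δ else 0 := by
  by_cases hb : ∃ b ∈ W, (P v).prefers c b
  · obtain ⟨b, hbW, hb⟩ := hb
    have hv : v ∉ opponents P W c := fun hv => (P v).asymm hb
      ((mem_opponents.mp hv).2 b hbW ((P v).ne_of_prefers hb).symm)
    rw [if_neg hv, add_zero, Ranking.veto, Ranking.veto, tsub_eq_zero_of_le, tsub_eq_zero_of_le]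
    · refine le_trans ?_ (Finset.le_sup (f := T) ((P v).mem_below.mpr hb))
      exact (h.le c).trans_eq (h.eq_of_mem b hbW).symm
    · refine le_trans ?_ (Finset.le_sup (f := fun b => if b ∈ W then t + δ else T b)
        ((P v).mem_below.mpr hb))
      simp only [hbW, if_true]
      split_ifs
      · exact le_rfl
      · exact (h.le c).trans le_self_add
  · push Not at hb
    have hs : ((P v).below c).sup (fun b => if b ∈ W then t + δ else T b) =
        ((P v).below c).sup T := Finset.sup_congr rfl fun b hb' =>
      if_neg fun hbW => hb b hbW ((P v).mem_below.mp hb')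
    rw [Ranking.veto, Ranking.veto, hs]
    by_cases hc : c ∈ W
    · have hv : v ∈ opponents P W c := mem_opponents.mpr ⟨hc, fun b hbW hne =>
        ((P v).total b c hne).resolve_right (hb b hbW)⟩
      rw [if_pos hc, if_pos hv, h.eq_of_mem c hc]
      exact tsub_add_eq_add_tsub (Finset.sup_le fun b _ => h.le b) |>.symm
    · have hv : v ∉ opponents P W c := fun hv => hc (mem_opponents.mp hv).1
      rw [if_neg hc, if_neg hv, add_zero]

theorem advance (h : IsPartialSchedule P q wt W t T l) (δ : ℝ≥0)
    (hδ : ∀ c ∈ W, δ * vetoRate P (fun _ => 1) W c ≤ wt c) :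
    ∃ T' l', IsPartialSchedule P q (fun c => wt c - δ * vetoRate P (fun _ => 1) W c) W (t + δ)
      T' l' := by
  classical
  have hrate : ∀ c ∉ W, vetoRate P (fun _ => 1) W c = 0 := fun c hc =>
    Finset.sum_eq_zero fun v hv => absurd (mem_opponents.mp hv).1 hc
  have hT : ∀ c, T c ≤ if c ∈ W then t + δ else T c := fun c => by
    split_ifs
    · exact (h.le c).trans le_self_add
    · exact le_rfl
  refine ⟨fun c => if c ∈ W then t + δ else T c, l, h.nonempty, fun c hc => if_pos hc, ?_, ?_, ?_,
    ?_, ?_, h.opposed, ?_⟩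
  · intro c
    split_ifs
    · exact le_rfl
    · exact (h.le c).trans le_self_add
  · intro c hc
    simpa only [if_neg hc] using h.lt_one c hc
  · intro c
    by_cases hc : c ∈ W
    · linarith [hδ c hc]
    · rw [hrate c hc, mul_zero, sub_zero]
      exact h.weight_nonneg c
  · intro c
    simp_rw [h.veto_add δ]
    rw [Finset.sum_add_distrib, ← Finset.sum_filter, Finset.sum_const, nsmul_eq_mul, vetoRate_eq_card,
      ← h.weight_add c]
    have : Finset.univ.filter (fun v => v ∈ opponents P W c) = opponents P W c := by
      ext v; simp
    rw [this]
    push_cast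
    ring
  · intro c hc
    rw [hrate c hc, mul_zero, sub_zero]
    exact h.weight_zero c hc
  · intro c hc b hbc
    simp only [if_neg hc] at hbc
    exact h.lt_of_lt c hc b ((hT b).trans_lt hbc)

end IsPartialSchedule

/-! ### Progress and termination of the loop. -/

theorem not_nonempty_exhausted_eliminate (P : Profile V C) (wt : C → ℝ) (W : Finset C) :
    ¬ (exhausted P wt (eliminate P wt W)).Nonempty := by
  classical
  induction hn : W.card using Nat.strong_induction_on generalizing W with
  | _ n ih =>
    rw [eliminate]
    split_ifs with hX
    · refine ih _ ?_ _ rfl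
      exact hn ▸ card_sdiff_exhausted_lt hX
    · exact hX

theorem eliminate_subset (P : Profile V C) (wt : C → ℝ) (W : Finset C) :
    eliminate P wt W ⊆ W := by
  classical
  induction hn : W.card using Nat.strong_induction_on generalizing W with
  | _ n ih =>
    rw [eliminate]
    split_ifs with hX
    · refine (ih _ ?_ _ rfl).trans Finset.sdiff_subset
      exact hn ▸ card_sdiff_exhausted_lt hX
    · exact subset_rfl

/-- The state arises from the initial weights `q` by some eliminations. -/
def IsReachable (P : Profile V C) (q : C → ℝ) (s : VetoState C) : Prop :=
  ∃ (t : ℝ≥0) (T : C → ℝ≥0) (l : C → ℕ), s.time = t ∧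
    IsPartialSchedule P q s.weight s.remaining t T l

open Classical in
/-- The number of candidates of positive weight. -/
noncomputable def VetoState.numPos (s : VetoState C) : ℕ :=
  (Finset.univ.filter fun c => 0 < s.weight c).card

/-- The ratios form a finite set, nonempty because any voter has a bottom choice in `W`; so the
infimum is attained. -/
theorem timeToNext_spec [Nonempty V] (P : Profile V C) (wt : C → ℝ) (W : Finset C)
    (hW : W.Nonempty) : ∃ c ∈ W, 0 < vetoRate P (fun _ => 1) W c ∧
      timeToNext P (fun _ => 1) wt W = wt c / vetoRate P (fun _ => 1) W c ∧
      ∀ b ∈ W, 0 < vetoRate P (fun _ => 1) W b →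
        timeToNext P (fun _ => 1) wt W ≤ wt b / vetoRate P (fun _ => 1) W b := by
  classical
  set S := {δ | ∃ c ∈ W, 0 < vetoRate P (fun _ => 1) W c ∧
    δ = wt c / vetoRate P (fun _ => 1) W c} with hS
  have hfin : S.Finite := by
    refine (W.finite_toSet.image fun c => wt c / vetoRate P (fun _ => 1) W c).subset ?_
    rintro δ ⟨c, hc, -, rfl⟩
    exact ⟨c, hc, rfl⟩
  have hne : S.Nonempty := by
    obtain ⟨v⟩ := ‹Nonempty V›
    obtain ⟨c, hc, hbot⟩ := (P v).exists_bottom W hW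
    refine ⟨_, c, hc, ?_, rfl⟩
    rw [vetoRate_eq_card]
    exact_mod_cast Finset.card_pos.mpr ⟨v, mem_opponents.mpr ⟨hc, hbot⟩⟩
  obtain ⟨c, hc, hpos, heq⟩ := hne.csInf_mem hfin
  exact ⟨c, hc, hpos, heq, fun b hb hb' => csInf_le hfin.bddBelow ⟨b, hb, hb', rfl⟩⟩

theorem IsReachable.step [Nonempty V] {P : Profile V C} {q : C → ℝ}
    (hq : ∑ c, q c = Fintype.card V) {s : VetoState C} (h : IsReachable P q s)
    (hs : s.time < 1) : IsReachable P q (vetoStep P (fun _ => 1) s) ∧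
      (vetoStep P (fun _ => 1) s).numPos < s.numPos := by
  classical
  obtain ⟨t, T, l, hst, h⟩ := h
  have ht : t < 1 := by rw [hst] at hs; exact_mod_cast hs
  obtain ⟨l', h'⟩ := h.eliminate hq ht
  rw [vetoStep, if_pos hs]
  dsimp only
  set W := eliminate P s.weight s.remaining
  have hex : ∀ c ∈ W, 0 < vetoRate P (fun _ => 1) W c → 0 < s.weight c := by
    intro c hc hpos
    refine lt_of_le_of_ne (h.weight_nonneg c) fun h0 => ?_
    refine not_nonempty_exhausted_eliminate P s.weight s.remaining
      ⟨c, mem_exhausted.mpr ⟨hc, h0.symm, ?_⟩⟩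
    rw [vetoRate_eq_card] at hpos
    exact Finset.card_pos.mp (by exact_mod_cast hpos)
  have hnn : ∀ c, 0 ≤ vetoRate P (fun _ => 1) W c := fun c =>
    Finset.sum_nonneg fun _ _ => zero_le_one
  obtain ⟨c, hc, hpos, heq, hmin⟩ := timeToNext_spec P s.weight W h'.nonempty
  set δ := timeToNext P (fun _ => 1) s.weight W
  have hδ : 0 ≤ δ := heq ▸ div_nonneg (h.weight_nonneg c) hpos.le
  obtain ⟨d, hd⟩ : ∃ d : ℝ≥0, (d : ℝ) = δ := ⟨⟨δ, hδ⟩, rfl⟩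
  obtain ⟨T', l'', h''⟩ := h'.advance d fun b hb => by
    rw [hd]
    rcases (hnn b).eq_or_lt with h0 | h0
    · rw [← h0, mul_zero]
      exact h.weight_nonneg b
    · exact (le_div_iff₀ h0).mp (hmin b hb h0)
  rw [hd] at h''
  refine ⟨⟨t + d, T', l'', ?_, h''⟩, ?_⟩
  · rw [hst, NNReal.coe_add, hd]
  -- Weights never grow, and the minimizing candidate `c` drops from positive weight to exactly `0`.
  · refine Finset.card_lt_card ⟨fun b hb => ?_, fun hsub => ?_⟩
    · simp only [Finset.mem_filter, Finset.mem_univ, true_and] at hb ⊢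
      linarith [mul_nonneg hδ (hnn b)]
    · have := hsub (by simpa using hex c hc hpos : c ∈ Finset.univ.filter fun c => 0 < s.weight c)
      simp only [Finset.mem_filter, Finset.mem_univ, true_and] at this
      rw [heq, div_mul_cancel₀ _ hpos.ne', sub_self] at this
      exact lt_irrefl _ this

theorem vetoStep_remaining_subset (P : Profile V C) (p : V → ℝ) (s : VetoState C) :
    (vetoStep P p s).remaining ⊆ s.remaining := by
  rw [vetoStep]
  split_ifs
  · exact eliminate_subset P s.weight s.remaining
  · exact subset_rfl

theorem vetoRun_succ (P : Profile V C) (p : V → ℝ) (q : C → ℝ) (k : ℕ) :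
    vetoRun P p q (k + 1) = vetoStep P p (vetoRun P p q k) :=
  Function.iterate_succ_apply' _ _ _

theorem simultaneousVeto_eq (P : Profile V C) (p : V → ℝ) (q : C → ℝ) {k : ℕ}
    (hk : (vetoRun P p q k).time = 1) :
    simultaneousVeto P p q = ↑(vetoRun P p q k).remaining := by
  have hanti : Antitone fun j => (vetoRun P p q j).remaining :=
    antitone_nat_of_succ_le fun j => by
      rw [vetoRun_succ]
      exact vetoStep_remaining_subset P p _
  have hconst : ∀ j, vetoRun P p q (k + j) = vetoRun P p q k := fun j => by
    induction j with
    | zero => rfl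
    | succ j ih => rw [← add_assoc, vetoRun_succ, ih, vetoStep, if_neg (by rw [hk]; exact lt_irrefl _)]
  ext c
  refine ⟨fun h => h k, fun h j => ?_⟩
  rcases le_total j k with hj | hj
  · exact hanti hj h
  · obtain ⟨i, rfl⟩ := Nat.exists_eq_add_of_le hj
    rw [hconst]
    exact h

theorem isReachable_initial [Nonempty C] (P : Profile V C) {q : C → ℝ} (hq : ∀ c, 0 ≤ q c) :
    IsReachable P q { remaining := Finset.univ, weight := q, time := 0 } :=
  ⟨0, fun _ => 0, fun _ => 0, rfl,
    { nonempty := Finset.univ_nonempty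
      eq_of_mem := fun _ _ => rfl
      le := fun _ => le_rfl
      lt_one := fun c hc => absurd (Finset.mem_univ c) hc
      weight_nonneg := hq
      weight_add := fun c => by simp [Ranking.veto]
      weight_zero := fun c hc => absurd (Finset.mem_univ c) hc
      opposed := fun c hc => absurd (Finset.mem_univ c) hc
      lt_of_lt := fun c hc => absurd (Finset.mem_univ c) hc }⟩

theorem isReachable_vetoRun [Nonempty V] [Nonempty C] (P : Profile V C) {q : C → ℝ}
    (hq0 : ∀ c, 0 ≤ q c) (hq : ∑ c, q c = Fintype.card V) (k : ℕ) :
    IsReachable P q (vetoRun P (fun _ => 1) q k) := by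
  induction k with
  | zero => exact isReachable_initial P hq0
  | succ k ih =>
    rw [vetoRun_succ]
    by_cases hs : (vetoRun P (fun _ => 1) q k).time < 1
    · exact (ih.step hq hs).1
    · rwa [vetoStep, if_neg hs]

/-- Total weight `n (1 - t)` stays nonnegative, so time cannot overshoot `1`; and `numPos` cannot
decrease strictly forever. -/
theorem exists_time_eq_one [Nonempty V] [Nonempty C] (P : Profile V C) {q : C → ℝ}
    (hq0 : ∀ c, 0 ≤ q c) (hq : ∑ c, q c = Fintype.card V) :
    ∃ k, (vetoRun P (fun _ => 1) q k).time = 1 := by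
  by_contra! hne
  have hr := isReachable_vetoRun P hq0 hq
  have hlt : ∀ k, (vetoRun P (fun _ => 1) q k).time < 1 := fun k => by
    obtain ⟨t, T, l, ht, h⟩ := hr k
    refine lt_of_le_of_ne ?_ (hne k)
    rw [ht]
    exact_mod_cast h.le_one hq
  have hanti : StrictAnti fun k => (vetoRun P (fun _ => 1) q k).numPos :=
    strictAnti_nat_of_succ_lt fun k => by
      rw [vetoRun_succ]
      exact ((hr k).step hq (hlt k)).2
  exact not_strictAnti_of_wellFoundedLT _ hanti

theorem IsReachable.exists_isVetoSchedule [Nonempty V] {P : Profile V C} {q : C → ℝ≥0}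
    (hq : ∑ c, q c = Fintype.card V) {s : VetoState C}
    (h : IsReachable P (fun c => (q c : ℝ)) s) (hs : s.time = 1) :
    ∃ T l, IsVetoSchedule P q T l ∧ (s.remaining : Set C) = {c | T c = 1} := by
  classical
  obtain ⟨t, T, l, hst, h⟩ := h
  obtain rfl : t = 1 := by
    rw [hs] at hst
    exact_mod_cast hst.symm
  -- At time `1` the total weight is zero, so every candidate has been vetoed for exactly its
  -- initial weight.
  have hw : ∀ c, s.weight c = 0 := by
    have h0 := h.sum_weight (by exact_mod_cast hq)
    rw [NNReal.coe_one, sub_self, mul_zero] at h0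
    exact fun c => (Finset.sum_eq_zero_iff_of_nonneg fun c _ => h.weight_nonneg c).mp h0 c
      (Finset.mem_univ c)
  have hN : ∀ b, l b < Finset.univ.sup l + 1 := fun b =>
    Nat.lt_succ_of_le (Finset.le_sup (f := l) (Finset.mem_univ b))
  refine ⟨T, fun c => if c ∈ s.remaining then Finset.univ.sup l + 1 else l c,
    ⟨h.le, fun c => ?_, fun c hc => ?_, fun b c hbc => ?_⟩, ?_⟩
  · have := h.weight_add c
    rw [hw, zero_add] at this
    exact_mod_cast this
  · have hcW : c ∉ s.remaining := fun hcW => hc.ne (h.eq_of_mem c hcW)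
    obtain ⟨v, hv⟩ := h.opposed c hcW
    refine ⟨v, fun b hb => ?_⟩
    simp only [hcW, (hv b hb).1, if_false]
    exact (hv b hb).2
  · have hbW := h.notMem_of_lt hbc
    by_cases hcW : c ∈ s.remaining
    · simp only [hbW, hcW, if_true, if_false]
      exact hN b
    · simp only [hbW, hcW, if_false]
      exact h.lt_of_lt c hcW b hbc
  · ext c
    exact ⟨fun hc => h.eq_of_mem c hc, fun hc => by_contra fun hc' => (h.lt_one c hc').ne hc⟩

/-- The plurality scores as initial weights. -/
noncomputable def pluWeight (P : Profile V C) (c : C) : ℝ≥0 := plu P c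

theorem sum_pluWeight [Nonempty C] (P : Profile V C) : ∑ c, pluWeight P c = Fintype.card V := by
  rw [← sum_plu P]
  simp [pluWeight]

theorem exists_isVetoSchedule [Nonempty V] [Nonempty C] (P : Profile V C) :
    ∃ T l, IsVetoSchedule P (pluWeight P) T l ∧
      simultaneousPluralityVeto V C P = {c | T c = 1} := by
  have hq : ∑ c, (plu P c : ℝ) = Fintype.card V := by exact_mod_cast sum_plu P
  have hq0 : ∀ c, (0 : ℝ) ≤ plu P c := fun c => Nat.cast_nonneg _
  obtain ⟨k, hk⟩ := exists_time_eq_one P hq0 hq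
  obtain ⟨T, l, h, hW⟩ := IsReachable.exists_isVetoSchedule (q := pluWeight P) (sum_pluWeight P)
    (isReachable_vetoRun P hq0 hq k) hk
  exact ⟨T, l, h, (simultaneousVeto_eq P _ _ hk).trans hW⟩

end Execution

/-! ### Distortion -/

section Distortion

variable {V : Type u} {C : Type v} [Fintype V] [Fintype C]

/-- A candidate that admits a plurality matching has at most three times the cost of any other. -/
theorem sum_dist_le_of_mem_tiedAt [Nonempty C] {P : Profile V C} {M : V → C → ℝ}
    (hM : IsMatching (fun _ => 1) (fun c => (plu P c : ℝ)) M) {a : C} (ha : a ∈ tiedAt P M)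
    (m : PseudoMetricSpace (V ⊕ C))
    (hm : Consistent P fun v a => m.dist (Sum.inl v) (Sum.inr a)) (b : C) :
    ∑ v, m.dist (Sum.inl v) (Sum.inr a) ≤ 3 * ∑ v, m.dist (Sum.inl v) (Sum.inr b) := by
  classical
  obtain ⟨hM0, hMv, hMc⟩ := hM
  -- The left-hand side sums the distance from `b` to each voter's top choice, which is no farther
  -- from her than `b`.
  have htop : ∑ c, (plu P c : ℝ) * m.dist (Sum.inr b) (Sum.inr c) ≤
      2 * ∑ v, m.dist (Sum.inl v) (Sum.inr b) := by
    have h : ∑ c, (plu P c : ℝ) * m.dist (Sum.inr b) (Sum.inr c) =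
        ∑ v, ∑ c, if (P v).IsTop c then m.dist (Sum.inr b) (Sum.inr c) else 0 := by
      rw [Finset.sum_comm]
      refine Finset.sum_congr rfl fun c _ => ?_
      rw [← Finset.sum_filter, Finset.sum_const, nsmul_eq_mul]
      unfold plu
      congr!
    rw [h, Finset.mul_sum]
    refine Finset.sum_le_sum fun v _ => ?_
    obtain ⟨c, hc⟩ := (P v).exists_isTop
    rw [Finset.sum_eq_single c (fun c' _ hne => if_neg fun hc' => hne (hc'.eq hc))
      (fun hc' => absurd (Finset.mem_univ c) hc'), if_pos hc]
    have h1 := m.dist_triangle (Sum.inr b) (Sum.inl v) (Sum.inr c)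
    have h2 := m.dist_comm (Sum.inr b) (Sum.inl v)
    have h3 : m.dist (Sum.inl v) (Sum.inr c) ≤ m.dist (Sum.inl v) (Sum.inr b) := by
      by_cases hbc : b = c
      · rw [hbc]
      · exact hm v c b (hc b hbc)
    linarith
  calc ∑ v, m.dist (Sum.inl v) (Sum.inr a)
      = ∑ v, ∑ c, M v c * m.dist (Sum.inl v) (Sum.inr a) := by
        refine Finset.sum_congr rfl fun v _ => ?_
        rw [← Finset.sum_mul, hMv, one_mul]
    -- On the support of `M`, `a` is no farther from `v` than `c`; then go from `v` to `c` through
    -- `b`.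
    _ ≤ ∑ v, ∑ c, M v c * (m.dist (Sum.inl v) (Sum.inr b) + m.dist (Sum.inr b) (Sum.inr c)) := by
        refine Finset.sum_le_sum fun v _ => Finset.sum_le_sum fun c _ => ?_
        by_cases h0 : M v c = 0
        · simp [h0]
        · refine mul_le_mul_of_nonneg_left (le_trans ?_ (m.dist_triangle _ _ _)) (hM0 v c)
          rcases ha v c h0 with rfl | h
          · exact le_rfl
          · exact hm v a c h
    _ = ∑ v, m.dist (Sum.inl v) (Sum.inr b) +
          ∑ c, (plu P c : ℝ) * m.dist (Sum.inr b) (Sum.inr c) := by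
        simp_rw [mul_add, Finset.sum_add_distrib, ← Finset.sum_mul, hMv, one_mul]
        congr 1
        rw [Finset.sum_comm]
        exact Finset.sum_congr rfl fun c _ => by rw [← Finset.sum_mul, hMc]
    _ ≤ 3 * ∑ v, m.dist (Sum.inl v) (Sum.inr b) := by linarith

theorem distortion_le_three [Nonempty C] {P : Profile V C} {M : V → C → ℝ}
    (hM : IsMatching (fun _ => 1) (fun c => (plu P c : ℝ)) M) {a : C} (ha : a ∈ tiedAt P M) :
    distortion P a ≤ 3 := by
  refine iSup₂_le fun m hm => ENNReal.div_le_of_le_mul ?_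
  rw [ENNReal.mul_iInf_of_ne (by norm_num) (by norm_num)]
  refine le_iInf fun b => ?_
  rw [cost, cost, ← ENNReal.ofReal_ofNat 3, ← ENNReal.ofReal_mul (by norm_num)]
  exact ENNReal.ofReal_le_ofReal (sum_dist_le_of_mem_tiedAt hM ha m hm b)

end Distortion

/-! ### Convexity -/

/-- If `c` is ranked behind all of `W` by some voter, `c` is not placed in the interior of any
hull of `W` that respects closed balls. -/
theorem notMem_interior_hull {V : Type u} {C : Type v} {X : Type w} [PseudoMetricSpace X]
    {P : Profile V C} {W : Set C} {c : C} {v : V} (hv : ∀ a ∈ W, (P v).prefers a c)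
    (hull : ClosureOperator (Set X)) (hball : ∀ z r, hull.IsClosed (Metric.closedBall z r))
    (hint : ∀ (z : X) (r : ℝ), interior (Metric.closedBall z r) = Metric.ball z r)
    {x : V → X} {y : C → X} (hd : Consistent P (fun v c => dist (x v) (y c))) :
    y c ∉ interior (hull (y '' W)) := by
  intro h
  have hsub : y '' W ⊆ Metric.closedBall (x v) (dist (x v) (y c)) := by
    rintro _ ⟨a, ha, rfl⟩
    rw [Metric.mem_closedBall, dist_comm]
    exact hd v a c (hv a ha)
  have h1 : hull (y '' W) ⊆ Metric.closedBall (x v) (dist (x v) (y c)) :=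
    hull.closure_min hsub (hball _ _)
  have h2 := interior_mono h1 h
  rw [hint, Metric.mem_ball, dist_comm] at h2
  exact lt_irrefl _ h2

/-- A closed ball is the intersection of the larger concentric open balls. -/
theorem isClosed_hull_closedBall {X : Type w} [PseudoMetricSpace X]
    (hull : ClosureOperator (Set X)) (hball : ∀ z r, hull.IsClosed (Metric.ball z r)) (z : X)
    (r : ℝ) : hull.IsClosed (Metric.closedBall z r) := by
  rw [hull.isClosed_iff_closure_le]
  intro p hp
  rw [Metric.mem_closedBall]
  refine le_of_forall_gt fun s hs => ?_
  exact hull.closure_min (Metric.closedBall_subset_ball hs) (hball z s) hp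

/-! ### Axioms -/

section Axioms

/-- Hence any schedule that can be exhibited determines the winners. -/
theorem IsVetoSchedule.eq {V : Type u} {C : Type v} [Fintype V] [Fintype C] {P : Profile V C}
    {q T T' : C → ℝ≥0} {l l' : C → ℕ} (h : IsVetoSchedule P q T l)
    (h' : IsVetoSchedule P q T' l') : T = T' :=
  funext fun c => le_antisymm
    (h'.le_of_embedding h (Function.Embedding.refl V) (fun _ _ => le_rfl) (fun _ _ _ _ h => h) c)
    (h.le_of_embedding h' (Function.Embedding.refl V) (fun _ _ => le_rfl) (fun _ _ _ _ h => h) c)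

theorem IsVetoSchedule.winners_eq {V : Type u} {C : Type v} [Fintype V] [Nonempty V] [Fintype C]
    [Nonempty C] {P : Profile V C} {T : C → ℝ≥0} {l : C → ℕ}
    (h : IsVetoSchedule P (pluWeight P) T l) :
    simultaneousPluralityVeto V C P = {c | T c = 1} := by
  obtain ⟨T', l', h', hW⟩ := exists_isVetoSchedule P
  rw [hW, h'.eq h]

theorem anonymity_simultaneousPluralityVeto : Anonymity simultaneousPluralityVeto.{u, v} := by
  classical
  intro V V' C _ _ _ _ _ _ e P
  obtain ⟨T, l, h, hW⟩ := exists_isVetoSchedule P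
  have hplu : pluWeight (fun v => P (e v)) = pluWeight P := by
    funext c
    unfold pluWeight plu
    congr 1
    exact Finset.card_equiv e (by simp)
  rw [hW]
  refine IsVetoSchedule.winners_eq (l := l) ⟨h.le_one, fun c => ?_, fun c hc => ?_, h.lt_of_lt⟩
  · rw [hplu, ← h.sum_veto c]
    exact e.sum_comp fun v => (P v).veto T c
  · obtain ⟨v, hv⟩ := h.opposed c hc
    exact ⟨e.symm v, by simpa using hv⟩

theorem Ranking.isTop_rename {C C' : Type v} (e : C ≃ C') (r : Ranking C) (c : C') :
    (r.rename e).IsTop c ↔ r.IsTop (e.symm c) := by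
  constructor
  · intro h b hb
    have := h (e b) (by rintro rfl; simp at hb)
    simpa [Ranking.rename] using this
  · exact fun h b hb => h _ fun h' => hb (e.symm.injective h')

theorem Ranking.veto_rename {C C' : Type v} [Fintype C] [Fintype C'] (e : C ≃ C') (r : Ranking C)
    (T : C → ℝ≥0) (c : C') : (r.rename e).veto (T ∘ e.symm) c = r.veto T (e.symm c) := by
  rw [Ranking.veto, Ranking.veto, Function.comp_apply]
  congr 1
  refine eq_of_forall_ge_iff fun t => ?_
  rw [Ranking.sup_below_le, Ranking.sup_below_le]
  exact ⟨fun h b hb => by simpa using h (e b) (by simpa [Ranking.rename] using hb),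
    fun h b hb => h _ hb⟩

theorem neutrality_simultaneousPluralityVeto : Neutrality simultaneousPluralityVeto.{u, v} := by
  intro V C C' _ _ _ _ _ _ e P
  obtain ⟨T, l, h, hW⟩ := exists_isVetoSchedule P
  have hs : IsVetoSchedule (fun v => (P v).rename e) (pluWeight fun v => (P v).rename e)
      (T ∘ e.symm) (l ∘ e.symm) := by
    refine ⟨fun c => h.le_one _, fun c => ?_, fun c hc => ?_, fun b c => h.lt_of_lt _ _⟩
    · simp_rw [Ranking.veto_rename]
      rw [h.sum_veto]
      unfold pluWeight plu
      congr 2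
      ext v
      simp [Ranking.isTop_rename]
    · obtain ⟨v, hv⟩ := h.opposed _ hc
      exact ⟨v, fun b hb => hv _ hb⟩
  rw [hs.winners_eq, hW]
  ext c
  simp

theorem plu_addVoter_of_ne {V : Type u} {C : Type v} [Fintype V] (P : Profile V C)
    {r : Ranking C} {c : C} (hc : ¬ r.IsTop c) : plu (addVoter P r) c = plu P c := by
  classical
  unfold plu
  simp_rw [Finset.card_filter]
  rw [Fintype.sum_option, if_neg (show ¬ (addVoter P r none).IsTop c from hc), zero_add]
  rfl

theorem resolvability_simultaneousPluralityVeto :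
    Resolvability simultaneousPluralityVeto.{u, v} := by
  classical
  intro V C _ _ _ _ P r w hw hr
  obtain ⟨T, l, h, hW⟩ := exists_isVetoSchedule P
  obtain ⟨T', l', h', hW'⟩ := exists_isVetoSchedule (addVoter P r)
  rw [hW] at hw
  rw [hW']
  have hq : ∀ c, c ≠ w → pluWeight (addVoter P r) c = pluWeight P c := fun c hc => by
    rw [pluWeight, plu_addVoter_of_ne P fun hc' => hc (hc'.eq hr), pluWeight]
  have hle : ∀ c, T' c ≤ T c := h.le_of_embedding h' Function.Embedding.some
    (fun c hc => (hq c (by rintro rfl; exact hc.ne hw)).le) (fun _ _ _ _ hb => hb)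
  have hsub : ∀ c, T' c = 1 → c = w := by
    by_contra! hne
    obtain ⟨c₀, hc₀, hc₀w⟩ := hne
    -- The new voter vetoes this `c` for a positive time, but `c` also won before, and the old
    -- voters alone still use up its unchanged weight.
    obtain ⟨c, hc, hbot⟩ := r.exists_bottom (Finset.univ.filter fun c => T' c = 1)
      ⟨c₀, by simp [hc₀]⟩
    have hc1 : T' c = 1 := by simpa using hc
    have hcw : c ≠ w := by
      rintro rfl
      exact r.asymm (hr c₀ hc₀w) (hbot c₀ (by simp [hc₀]) hc₀w)
    have hT1 : T c = 1 := le_antisymm (h.le_one c) (hc1 ▸ hle c)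
    have hpos : 0 < r.veto T' c := by
      refine pos_iff_ne_zero.mpr ((r.veto_ne_zero T').mpr ⟨by simp [hc1], fun b hb => ?_⟩)
      rw [hc1]
      refine lt_of_le_of_ne (h'.le_one b) fun hb1 => ?_
      exact r.asymm hb (hbot b (by simp [hb1]) (r.ne_of_prefers hb).symm)
    have h1 := h'.sum_veto c
    rw [Fintype.sum_option, hq c hcw, ← h.sum_veto c] at h1
    have h2 : ∑ v, (P v).veto T c ≤ ∑ v, (addVoter P r (some v)).veto T' c :=
      Finset.sum_le_sum fun v _ => Ranking.veto_le_veto (by rw [hT1, hc1])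
        fun _ b hb => ⟨hb, hle b⟩
    have h3 : ∑ v, (P v).veto T c < r.veto T' c + ∑ v, (addVoter P r (some v)).veto T' c :=
      lt_add_of_pos_of_le hpos h2
    exact h3.ne' h1
  obtain ⟨c, hc⟩ := h'.exists_winner (sum_pluWeight _)
  ext a
  refine ⟨fun ha => hsub a ha, ?_⟩
  rintro rfl
  exact hsub c hc ▸ hc

theorem mutualMajority_simultaneousPluralityVeto :
    MutualMajority simultaneousPluralityVeto.{u, v} := by
  classical
  intro V C _ _ _ _ P S hS ⟨A, hA, hAS⟩ a ha
  obtain ⟨T, l, h, hW⟩ := exists_isVetoSchedule P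
  have hq := sum_pluWeight P
  rw [hW, h.eq_tiedAt hq] at ha
  by_contra haS
  set O := Finset.univ.filter fun c => c ∉ S
  -- With a winner `a` outside `S`, the majority must spend all its vetoes outside `S`, where fewer
  -- than half of the plurality votes lie.
  have hveto : ∀ v ∈ A, ∀ c ∈ S, (P v).veto T c = 0 := by
    intro v hv c hc
    by_contra hne
    rcases ha v c (NNReal.coe_ne_zero.mpr hne) with rfl | h'
    · exact haS hc
    · exact (P v).asymm h' (hAS v hv c hc a haS)
  have h1 : (A.card : ℝ≥0) ≤ ∑ c ∈ O, pluWeight P c := by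
    calc (A.card : ℝ≥0) = ∑ v ∈ A, ∑ c ∈ O, (P v).veto T c := by
          rw [Finset.sum_congr rfl fun v hv => ?_, Finset.sum_const, nsmul_eq_mul, mul_one]
          rw [← h.sup_eq_one hq, ← (P v).sum_veto]
          refine Finset.sum_subset (Finset.subset_univ _) fun c _ hc => hveto v hv c ?_
          simpa [O] using hc
      _ = ∑ c ∈ O, ∑ v ∈ A, (P v).veto T c := Finset.sum_comm
      _ ≤ ∑ c ∈ O, ∑ v, (P v).veto T c := Finset.sum_le_sum fun c _ =>
          Finset.sum_le_sum_of_subset (Finset.subset_univ A)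
      _ = ∑ c ∈ O, pluWeight P c := Finset.sum_congr rfl fun c _ => h.sum_veto c
  have h2 : A.card ≤ ∑ c ∈ O, plu P c := by
    simp only [pluWeight] at h1
    exact_mod_cast h1
  have h3 : ∑ c ∈ O, plu P c ≤ Aᶜ.card := by
    unfold plu
    rw [← Finset.card_biUnion]
    · refine Finset.card_le_card fun v hv => ?_
      obtain ⟨c, hc, hvc⟩ := Finset.mem_biUnion.mp hv
      have hvc' : (P v).IsTop c := by simpa using hvc
      have hc' : c ∉ S := by simpa [O] using hc
      refine Finset.mem_compl.mpr fun hvA => ?_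
      obtain ⟨s, hs⟩ := hS
      exact (P v).asymm (hAS v hvA s hs c hc') (hvc' s (by rintro rfl; exact hc' hs))
    · intro b _ c _ hne
      refine Finset.disjoint_left.mpr fun v hb hc => hne ?_
      simp only [Finset.mem_filter, Finset.mem_univ, true_and] at hb hc
      exact hb.eq hc
  rw [Finset.card_compl] at h3
  omega

theorem majority_simultaneousPluralityVeto : Majority simultaneousPluralityVeto.{u, v} :=
  fun V C _ _ _ _ P c h =>
    mutualMajority_simultaneousPluralityVeto V C P {c} (Set.singleton_nonempty c) h

theorem majorityLoser_simultaneousPluralityVeto :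
    MajorityLoser simultaneousPluralityVeto.{u, v} :=
  fun V C _ _ _ _ P c hc h => mutualMajority_simultaneousPluralityVeto V C P {c}ᶜ hc h

open Classical in
/-- The voters with bottom choice `w` spend all their time on vetoing `w`. -/
theorem IsVetoSchedule.pluWeight_reverse_add {V : Type u} {C : Type v} [Fintype V] [Fintype C]
    {P : Profile V C} {q T : C → ℝ≥0} {l : C → ℕ} (h : IsVetoSchedule P q T l) {w : C}
    (hw : T w = 1) :
    pluWeight (fun v => (P v).reverse) w +
      ∑ v with ¬ (P v).reverse.IsTop w, (P v).veto T w = q w := by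
  rw [← h.sum_veto w, ← Finset.sum_filter_add_sum_filter_not Finset.univ
    (fun v => (P v).reverse.IsTop w) fun v => (P v).veto T w]
  congr 1
  rw [Finset.sum_congr rfl (g := fun _ => 1), Finset.sum_const, nsmul_eq_mul, mul_one, pluWeight,
    plu]
  intro v hv
  have htop : (P v).reverse.IsTop w := by simpa using hv
  have hs : ((P v).below w).sup T ≤ 0 := ((P v).sup_below_le T).mpr fun b hb =>
    absurd (htop b ((P v).ne_of_prefers hb).symm) ((P v).asymm hb)
  rw [Ranking.veto, hw, nonpos_iff_eq_zero.mp hs, tsub_zero]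

theorem reversalSymmetry_simultaneousPluralityVeto :
    ReversalSymmetry simultaneousPluralityVeto.{u, v} := by
  classical
  intro V C _ _ _ _ P w hw hw'
  obtain ⟨T, l, h, hW⟩ := exists_isVetoSchedule P
  obtain ⟨T', l', h', hW'⟩ := exists_isVetoSchedule fun v => (P v).reverse
  rw [hW] at hw
  rw [hW'] at hw'
  have hTw : T w = 1 := hw.symm.subset rfl
  have h1 := h.pluWeight_reverse_add hTw
  -- Reversing twice returns `P` definitionally. Together with `h1`, the top and bottom counts of
  -- `w` agree, so only voters with bottom choice `w` veto it.
  have h2 : pluWeight P w ≤ pluWeight (fun v => (P v).reverse) w :=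
    le_self_add.trans_eq (h'.pluWeight_reverse_add hw')
  have h3 : ∑ v with ¬ (P v).reverse.IsTop w, (P v).veto T w = 0 :=
    nonpos_iff_eq_zero.mp (le_of_add_le_add_left
      ((h1.le.trans h2).trans_eq (add_zero _).symm))
  -- As the unique winner, `w` is vetoed by every voter at the end.
  have hbot : ∀ v, (P v).reverse.IsTop w := by
    intro v
    by_contra hv
    refine ((P v).veto_ne_zero T).mpr ⟨by simp [hTw], fun b hb => ?_⟩
      (Finset.sum_eq_zero_iff.mp h3 v (by simpa using hv))
    rw [hTw]
    exact lt_of_le_of_ne (h.le_one b) fun hb1 =>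
      (P v).ne_of_prefers hb (hw.subset (show T b = 1 from hb1)).symm
  have hplu : plu (fun v => (P v).reverse) w = Fintype.card V := by
    simp [plu, hbot]
  have hpos : 0 < plu P w := by
    rw [h3, add_zero, pluWeight, pluWeight, hplu, Nat.cast_inj] at h1
    exact h1 ▸ Fintype.card_pos
  obtain ⟨v, hv⟩ := Finset.card_pos.mp hpos
  obtain ⟨b, hb⟩ := exists_ne w
  exact (P v).asymm ((Finset.mem_filter.mp hv).2 b hb) (hbot v b hb)

/-- If the winner `w` is moved upwards by some voters, then it still wins. -/
theorem IsVetoSchedule.eq_one_of_isLift {V : Type u} {C : Type v} [Fintype V] [Nonempty V]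
    [Fintype C] [Nonempty C] {P P' : Profile V C} {q q' T T' : C → ℝ≥0} {l l' : C → ℕ} {w : C}
    (h : IsVetoSchedule P q T l) (h' : IsVetoSchedule P' q' T' l')
    (hsum : ∑ c, q c = Fintype.card V) (hsum' : ∑ c, q' c = Fintype.card V)
    (hq : ∀ c, c ≠ w → q' c ≤ q c) (hP : ∀ v, Ranking.IsLift w (P v) (P' v)) (hw : T w = 1) :
    T' w = 1 := by
  classical
  have hbelow : ∀ v c b, c ≠ w → (P' v).prefers c b → (P v).prefers c b := by
    intro v c b hc hb
    by_cases hbw : b = w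
    · subst hbw
      exact ((P v).total c b hc).resolve_right fun hb' => (P' v).asymm hb ((hP v).2 c hb')
    · exact ((hP v).1 c b hc hbw).mp hb
  have hle : ∀ c, T' c ≤ T c := h.le_of_embedding h' (Function.Embedding.refl V)
    (fun c hc => hq c (by rintro rfl; exact hc.ne hw))
    (fun v c b hc hb => hbelow v c b (by rintro rfl; exact hc.ne hw) hb)
  by_contra hne
  set t := T' w with ht
  have ht1 : t < 1 := lt_of_le_of_ne (h'.le_one w) hne
  have hsup : ∀ {Q : Profile V C} {p S : C → ℝ≥0} {k : C → ℕ}, IsVetoSchedule Q p S k →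
      ∑ c, p c = Fintype.card V →
      ∑ c, ∑ v, (Q v).veto (fun b => min (S b) t) c = Fintype.card V * t := by
    intro Q p S k hQ hp
    obtain ⟨c, hc⟩ := hQ.exists_winner hp
    have hs : Finset.univ.sup (fun b => min (S b) t) = t := by
      refine le_antisymm (Finset.sup_le fun b _ => min_le_right _ _) ?_
      refine le_trans ?_ (Finset.le_sup (f := fun b => min (S b) t) (Finset.mem_univ c))
      rw [hc, min_eq_right ht1.le]
    rw [Finset.sum_comm, Finset.sum_congr rfl fun v _ => (Q v).sum_veto _, hs, Finset.sum_const,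
      Finset.card_univ, nsmul_eq_mul]
  set a : C → ℝ≥0 := fun c => ∑ v, (P v).veto (fun b => min (T b) t) c
  set a' : C → ℝ≥0 := fun c => ∑ v, (P' v).veto (fun b => min (T' b) t) c
  have ha' : ∀ c, T' c ≤ t → a' c = q' c := fun c hc =>
    (Finset.sum_congr rfl fun v _ => (P' v).veto_min_of_le T' hc).trans (h'.sum_veto c)
  have ha : ∀ c, a c ≤ q c := fun c =>
    (Finset.sum_le_sum fun v _ => (P v).veto_min_le T t c).trans_eq (h.sum_veto c)
  -- Written without subtraction: at time `t` no candidate has more weight left in `P'` than in `P`.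
  -- The totals agree by `hsup`, so equality holds throughout.
  have hcmp : ∀ c ∈ Finset.univ, q' c + a c ≤ q c + a' c := by
    intro c _
    rcases le_or_gt (T' c) t with hc | hc
    · rw [ha' c hc, add_comm]
      exact add_le_add_left (ha c) _
    · have hcw : c ≠ w := by
        rintro rfl
        exact hc.ne ht
      refine add_le_add (hq c hcw) (Finset.sum_le_sum fun v _ => Ranking.veto_le_veto ?_ ?_)
      · rw [min_eq_right hc.le]
        exact min_le_right _ _
      · exact fun _ b hb => ⟨hbelow v c b hcw hb, min_le_min_right t (hle b)⟩
  have heq : ∀ c, T' c ≤ t → a c = q c := by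
    have hs : ∑ c, (q' c + a c) = ∑ c, (q c + a' c) := by
      rw [Finset.sum_add_distrib, Finset.sum_add_distrib, hsum, hsum', hsup h hsum, hsup h' hsum']
    intro c hc
    have := (Finset.sum_eq_sum_iff_of_le hcmp).mp hs c (Finset.mem_univ c)
    rw [ha' c hc, add_comm (q c)] at this
    exact add_left_cancel this
  -- In `P`, such a `c` has no weight left at time `t` but survives it, so nobody can be vetoing it
  -- just afterwards.
  have hunopposed : ∀ c v, T' c ≤ t → t < T c → ¬ ∀ b, (P v).prefers c b → T b ≤ t := by
    intro c v hc hc' hb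
    have hlt : a c < q c := by
      rw [← h.sum_veto c]
      exact Finset.sum_lt_sum (fun v _ => (P v).veto_min_le T t c)
        ⟨v, Finset.mem_univ v, (P v).veto_min_lt T hc' hb⟩
    exact hlt.ne (heq c hc)
  have hw' : t < T w := hw ▸ ht1
  -- Take the first candidate eliminated in `P'` by time `t` that outlives `t` in `P`. Its opponent
  -- `v` in `P'` will oppose `c` or `w` in `P` just after `t`.
  obtain ⟨c, hc, hmin⟩ := Finset.exists_min_image (Finset.univ.filter fun c => T' c ≤ t ∧ t < T c)
    l' ⟨w, by simp [← ht, hw']⟩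
  simp only [Finset.mem_filter, Finset.mem_univ, true_and] at hc hmin
  obtain ⟨v, hv⟩ := h'.opposed c (hc.1.trans_lt ht1)
  have hb' : ∀ b, (P' v).prefers c b → T b ≤ t := fun b hb => by
    by_contra! hbt
    exact (hmin b ⟨(h'.le_of_lt (hv b hb)).trans hc.1, hbt⟩).not_gt (hv b hb)
  by_cases hcw : c = w
  · subst hcw
    exact hunopposed c v hc.1 hc.2 fun b hb => hb' b ((hP v).2 b hb)
  · have hb : ∀ b, b ≠ w → (P v).prefers c b → T b ≤ t := fun b hbw hb =>
      hb' b (((hP v).1 c b hcw hbw).mpr hb)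
    -- If `w` was below `c` in `P`, then everything below `w` is gone by time `t` and `v` opposes
    -- `w`; otherwise she opposes `c`.
    by_cases hcw' : (P v).prefers c w
    · exact hunopposed w v le_rfl hw' fun b hwb =>
        hb b ((P v).ne_of_prefers hwb).symm ((P v).trans _ _ _ hcw' hwb)
    · exact hunopposed c v hc.1 hc.2 fun b hcb =>
        hb b (by rintro rfl; exact hcw' hcb) hcb

theorem monotonicity_simultaneousPluralityVeto :
    Monotonicity simultaneousPluralityVeto.{u, v} := by
  classical
  intro V C _ _ _ _ P P' v w hw hP hlift
  obtain ⟨T, l, h, hW⟩ := exists_isVetoSchedule P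
  obtain ⟨T', l', h', hW'⟩ := exists_isVetoSchedule P'
  rw [hW] at hw
  rw [hW']
  have hall : ∀ x, Ranking.IsLift w (P x) (P' x) := fun x => by
    by_cases hx : x = v
    · exact hx ▸ hlift
    · rw [hP x hx]
      exact ⟨fun _ _ _ _ => Iff.rfl, fun _ h => h⟩
  refine h.eq_one_of_isLift h' (sum_pluWeight P) (sum_pluWeight P') (fun c hc => ?_) hall hw
  refine Nat.cast_le.mpr (Finset.card_le_card fun x hx => ?_)
  simp only [Finset.mem_filter, Finset.mem_univ, true_and] at hx ⊢
  intro b hb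
  by_cases hbw : b = w
  · subst hbw
    exact ((P x).total c b hc).resolve_right fun hb' =>
      (P' x).asymm (hx b hb) ((hall x).2 c hb')
  · exact ((hall x).1 c b hc hbw).mp (hx b hb)

end Axioms

end SocialChoice

theorem mainTheorem1 :
    (∀ (V : Type u) (C : Type v) [Fintype V] [Nonempty V] [Fintype C] [Nonempty C]
      (P : Profile V C),
      -- the execution reaches time `1`, and the winners are the candidates remaining then
      (∃ k, (vetoRun P (fun _ => 1) (fun c => (plu P c : ℝ)) k).time = 1 ∧
        simultaneousPluralityVeto V C P =
          ↑(vetoRun P (fun _ => 1) (fun c => (plu P c : ℝ)) k).remaining) ∧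
      -- the winners form a nonempty set, and they are the winners tied at a plurality matching
      (simultaneousPluralityVeto V C P).Nonempty ∧
      (∃ M : V → C → ℝ, IsMatching (fun _ => 1) (fun c => (plu P c : ℝ)) M ∧
        simultaneousPluralityVeto V C P = tiedAt P M) ∧
      -- every winner has distortion at most `3`
      (∀ c ∈ simultaneousPluralityVeto V C P, distortion P c ≤ 3) ∧
      -- convexity in every consistent embedding into a real normed space
      (∀ (E : Type w) [NormedAddCommGroup E] [NormedSpace ℝ E] [Nontrivial E]
        (x : V → E) (y : C → E), Consistent P (fun v c => dist (x v) (y c)) →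
        ∀ c, y c ∈ interior (convexHull ℝ (y '' simultaneousPluralityVeto V C P)) →
          c ∈ simultaneousPluralityVeto V C P) ∧
      -- convexity in every consistent embedding into a metric space with a notion of convex hull
      -- for which open balls are convex, and where closed balls have the open balls as interiors
      (∀ (X : Type w) [PseudoMetricSpace X] (hull : ClosureOperator (Set X)),
        (∀ z r, hull.IsClosed (Metric.ball z r)) →
        (∀ (z : X) (r : ℝ), interior (Metric.closedBall z r) = Metric.ball z r) →
        ∀ (x : V → X) (y : C → X), Consistent P (fun v c => dist (x v) (y c)) →
        ∀ c, y c ∈ interior (hull (y '' simultaneousPluralityVeto V C P)) →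
          c ∈ simultaneousPluralityVeto V C P)) ∧
    Anonymity simultaneousPluralityVeto.{u, v} ∧
    Neutrality simultaneousPluralityVeto.{u, v} ∧
    Resolvability simultaneousPluralityVeto.{u, v} ∧
    Monotonicity simultaneousPluralityVeto.{u, v} ∧
    Majority simultaneousPluralityVeto.{u, v} ∧
    MajorityLoser simultaneousPluralityVeto.{u, v} ∧
    MutualMajority simultaneousPluralityVeto.{u, v} ∧
    ReversalSymmetry simultaneousPluralityVeto.{u, v} := by
  refine ⟨fun V C _ _ _ _ P => ?_, anonymity_simultaneousPluralityVeto,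
    neutrality_simultaneousPluralityVeto, resolvability_simultaneousPluralityVeto,
    monotonicity_simultaneousPluralityVeto, majority_simultaneousPluralityVeto,
    majorityLoser_simultaneousPluralityVeto, mutualMajority_simultaneousPluralityVeto,
    reversalSymmetry_simultaneousPluralityVeto⟩
  obtain ⟨T, l, h, hW⟩ := exists_isVetoSchedule P
  have hq := sum_pluWeight P
  have htied := h.eq_tiedAt hq
  have hM := h.isMatching hq
  have hvoter : ∀ c ∉ simultaneousPluralityVeto V C P,
      ∃ v, ∀ a ∈ simultaneousPluralityVeto V C P, (P v).prefers a c := by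
    rw [hW]
    exact fun c hc => h.exists_voter (lt_of_le_of_ne (h.le_one c) hc)
  refine ⟨?_, ?_, ⟨_, hM, hW.trans htied⟩, ?_, ?_, ?_⟩
  · obtain ⟨k, hk⟩ := exists_time_eq_one P (q := fun c => (plu P c : ℝ))
      (fun c => Nat.cast_nonneg _) (by exact_mod_cast sum_plu P)
    exact ⟨k, hk, simultaneousVeto_eq P _ _ hk⟩
  · rw [hW]
    exact h.exists_winner hq
  · rw [hW, htied]
    exact fun c hc => distortion_le_three hM hc
  · intro E _ _ _ x y hd c hc
    by_contra hcW
    obtain ⟨v, hv⟩ := hvoter c hcW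
    exact notMem_interior_hull hv (convexHull ℝ)
      (fun z r => (convexHull ℝ).isClosed_iff.mpr (convex_closedBall z r).convexHull_eq)
      -- Nontriviality of `E` is what covers radius `0`.
      (fun z r => interior_closedBall' z r) hd hc
  · intro X _ hull hball hint x y hd c hc
    by_contra hcW
    obtain ⟨v, hv⟩ := hvoter c hcW
    exact notMem_interior_hull hv hull (isClosed_hull_closedBall hull hball) hint hd hc
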